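/- **Setting.** Consider finitely many real-valued time series observed on a finite window $t_0,\dots,t_{\max}$; the temporal variables are the $X_t$, for $X$ a series and $t$ a time point. A *full-time DAG* (FT-DAG) is an acyclic directed graph on the temporal variables in which no edge goes from a later to an earlier time point. Its *summary causal graph* (SCG) is the directed graph on the series with $S_X\to S_Y$ iff $X_{t'}\to Y_t$ for some $t'\le t$. A *discrete-time dynamic structural causal model* consists of an FT-DAG $\mathcal G$, measurable structural equations $Y_t:=f^{y_t}(\mathrm{Pa}(Y_t,\mathcal G),L^{y_t}_t)$, and a joint law of the noise terms $L^{y_t}_t$; it induces a joint distribution $P$ of the temporal variables. The interventional law $P(\,\cdot\mid do(X_s=x))$ is the law obtained when the equation of $X_s$ is replaced by the constant $x$. Let $\mathcal G^s$ be an SCG. A model is called *admissible* (for $\mathcal G^s$) if the SCG of its FT-DAG is $\mathcal G^s$ and 1. (causal sufficiency) its noise terms are mutually independent, each one entering the equation of a single observed variable; 2. (faithfulness) every conditional independence $A\perp B\mid C$ between disjoint sets of variables that holds in $P$ is entailed by the causal Markov condition (each variable is independent of its non-descendants given its parents), that is, it holds in every distribution satisfying this condition for $\mathcal G$; 3. (stationarity)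 the structural functions are the same at all time points: the FT-DAG is invariant under time shifts inside the window, and $f^{y_s}=f^{y_t}$ up to the shift of the arguments whenever $s\le t$ and no argument of $f^{y_t}$ is shifted to a time before $t_0$. **s-identifiability.** The FT-MPDAG obtained from the distribution of an admissible model with FT-DAG $\mathcal G$, and from $\mathcal G^s$, is the following maximally oriented graph. Take all stationary FT-DAGs that entail the same conditional independencies (between disjoint sets) as $\mathcal G$ and whose SCG is $\mathcal G^s$. The FT-MPDAG contains the directed edge $u\to v$ if all of them contain $u\to v$, and the unoriented edge $u-v$ if some of them contains $u\to v$ and some of them contains $v\to u$. A pair $\{S_Z,S_X\}$ is *s-identifiable* if, for the distribution of every admissible model and every time point $t$, the FT-MPDAG has no unoriented edge between $Z_t$ and $X_t$. **Proposition.** Suppose that for every neighbour $S_Z$ of $S_X$ in $\mathcal G^s$ (that is, $Z\neq X$ and $S_Z\to S_X$ or $S_X\to S_Z$) the pair $\{S_Z,S_X\}$ is s-identifiable. Then for every series $Y$ and all time points $t-\gamma\le t$ in the window, the total effect $P(Y_t\mid do(x_{t-\gamma}))$ is identifiable: if two admissible models induce the same distribution $P$, and positivity holds at the treatment $X_{t-\gamma}$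 in both (the product of the law of $X_{t-\gamma}$ and the law of its parents is absolutely continuous with respect to the joint law of $X_{t-\gamma}$ and its parents), then the law of $Y_t$ under $do(X_{t-\gamma}=x)$ is the same in the two models for $P_{X_{t-\gamma}}$-almost every value $x$ (for a discrete treatment: for every $x$ with $P(X_{t-\gamma}=x)>0$). -/

import Mathlib

open MeasureTheory ProbabilityTheory

/-- The temporal variables `X_t`: a series `X : ι` together with a time point of the observation
window `t₀, …, t_max`, which has `T` points and is indexed by `Fin T`. -/
abbrev TVar (ι : Type*) (T : ℕ) := ι × Fin T

/-! ### Full-time DAGs and summary causal graphs -/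

/-- A full-time directed acyclic graph: no edge points backwards in time, and there is no directed
cycle. -/
structure FTDAG (ι : Type*) (T : ℕ) where
  edge : TVar ι T → TVar ι T → Prop
  temporal : ∀ u v, edge u v → u.2 ≤ v.2
  acyclic : ∀ v, ¬ Relation.TransGen edge v v

namespace FTDAG

variable {ι : Type*} {T : ℕ}

/-- `Pa(v, G)`. -/
def parents (G : FTDAG ι T) (v : TVar ι T) : Set (TVar ι T) := {u | G.edge u v}

/-- `De(v, G)`: everything reachable from `v` by a directed path (`v` itself included). -/
def descendants (G : FTDAG ι T) (v : TVar ι T) : Set (TVar ι T) :=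
  {u | Relation.ReflTransGen G.edge v u}

/-- `Nd(v, G)`. -/
def nonDescendants (G : FTDAG ι T) (v : TVar ι T) : Set (TVar ι T) := (G.descendants v)ᶜ

/-- Shift invariance of the edges inside the window: whether `X_{s} → Y_{t}` is an edge depends only
on the series `X`, `Y` and on the lag `t - s`. -/
def Stationary (G : FTDAG ι T) : Prop :=
  ∀ (X Y : ι) (s t s' t' : Fin T), (s : ℕ) + (t' : ℕ) = (s' : ℕ) + (t : ℕ) →
    (G.edge (X, s) (Y, t) ↔ G.edge (X, s') (Y, t'))

end FTDAG

/-- A summary causal graph: a directed graph on the series; cycles, pairs of opposite edges and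
self-loops are all allowed. -/
@[ext]
structure SCG (ι : Type*) where
  edge : ι → ι → Prop

/-- The SCG of a full-time DAG: `S_X → S_Y` iff `X_{t'} → Y_t` for some `t' ≤ t`. -/
def FTDAG.scg {ι : Type*} {T : ℕ} (G : FTDAG ι T) : SCG ι where
  edge X Y := ∃ t' t : Fin T, t' ≤ t ∧ G.edge (X, t') (Y, t)

/-- `C(S)`: the full-time DAGs compatible with the SCG `S`. -/
def SCG.compatible {ι : Type*} (S : SCG ι) (T : ℕ) : Set (FTDAG ι T) := {G | G.scg = S}

/-- `Ne(S_X, S)`: the other series that are joined to `X` by an edge, in either direction. -/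
def SCG.neighbours {ι : Type*} (S : SCG ι) (X : ι) : Set ι :=
  {Z | Z ≠ X ∧ (S.edge Z X ∨ S.edge X Z)}

/-! ### Conditional independence, the causal Markov condition, Markov equivalence -/

/-- The values `(ω u)_{u ∈ A}` of the variables in `A`. -/
def valuesOn {ι : Type*} {T : ℕ} (A : Set (TVar ι T)) (ω : TVar ι T → ℝ) : A → ℝ := fun u => ω u

theorem measurable_valuesOn {ι : Type*} {T : ℕ} (A : Set (TVar ι T)) :
    Measurable (valuesOn A) :=
  measurable_pi_iff.2 fun u => measurable_pi_apply (u : TVar ι T)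

section Independence

variable {ι : Type*} [Finite ι] {T : ℕ}

/-- The variables in `A` are independent of those in `B` given those in `C`, under `P`. -/
def CondIndepVars (P : Measure (TVar ι T → ℝ)) [IsFiniteMeasure P] (A B C : Set (TVar ι T)) :
    Prop :=
  CondIndepFun
    (MeasurableSpace.comap (valuesOn C) inferInstance)
    (measurable_valuesOn C).comap_le
    (valuesOn A) (valuesOn B) P

/-- The causal Markov condition: every variable is independent of its non-descendants given its
parents. -/
def CausalMarkov (P : Measure (TVar ι T → ℝ)) [IsFiniteMeasure P] (G : FTDAG ι T) : Prop :=
  ∀ v, CondIndepVars P {v} (G.nonDescendants v) (G.parents v)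

/-- The conditional independence statement `A ⫫ B | C` is entailed by the causal Markov condition
of `G`: it holds in every distribution that satisfies this condition. -/
def FTDAG.Entails (G : FTDAG ι T) (A B C : Set (TVar ι T)) : Prop :=
  ∀ (Q : Measure (TVar ι T → ℝ)) [IsProbabilityMeasure Q],
    CausalMarkov Q G → CondIndepVars Q A B C

/-- Faithfulness: all conditional independencies (between disjoint sets of variables) in the
distribution are entailed by the causal Markov condition. -/
def FaithfulTo (P : Measure (TVar ι T → ℝ)) [IsFiniteMeasure P] (G : FTDAG ι T) : Prop :=
  ∀ A B C : Set (TVar ι T), Disjoint A B → Disjoint A C → Disjoint B C →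
    CondIndepVars P A B C → G.Entails A B C

/-- `MEC(G)`: the full-time DAGs with the same set of conditional independencies as `G`. -/
def FTDAG.mec (G : FTDAG ι T) : Set (FTDAG ι T) :=
  {G' | ∀ A B C : Set (TVar ι T), Disjoint A B → Disjoint A C → Disjoint B C →
    (G'.Entails A B C ↔ G.Entails A B C)}

end Independence

/-! ### The maximally oriented partially directed graph and the orientation operator -/

/-- A partially directed graph on the temporal variables. -/
structure PartiallyDirectedGraph (ι : Type*) (T : ℕ) where
  directed : TVar ι T → TVar ι T → Prop
  undirected : TVar ι T → TVar ι T → Prop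

section MPDAG

variable {ι : Type*} [Finite ι] {T : ℕ}

/-- The full-time DAGs that remain possible after causal discovery with the SCG as background
knowledge: the stationary members of `MEC(G)` that are compatible with `S`. -/
def FTDAG.discoveryClass (G : FTDAG ι T) (S : SCG ι) : Set (FTDAG ι T) :=
  {G' | G' ∈ G.mec ∧ G' ∈ S.compatible T ∧ G'.Stationary}

/-- The FT-MPDAG of `MEC(G)` with the background knowledge `S`, maximally oriented: an edge is
directed when all the remaining full-time DAGs contain it with this direction, and it is undirected
when both directions occur among them. -/
def FTDAG.mpdag (G : FTDAG ι T) (S : SCG ι) : PartiallyDirectedGraph ι T where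
  directed u v := ∀ G' ∈ G.discoveryClass S, G'.edge u v
  undirected u v :=
    (∃ G' ∈ G.discoveryClass S, G'.edge u v) ∧ (∃ G' ∈ G.discoveryClass S, G'.edge v u)

end MPDAG

/-- The possible values of `orient(u, v; H)`: `u → v`, `v → u`, `0` (no edge), `1` (an unoriented
edge). -/
inductive EdgeOrientation
  | forward
  | backward
  | noEdge
  | unoriented

open Classical in
/-- `orient(u, v; H)`. -/
noncomputable def PartiallyDirectedGraph.orient {ι : Type*} {T : ℕ}
    (H : PartiallyDirectedGraph ι T) (u v : TVar ι T) : EdgeOrientation :=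
  if H.directed u v then .forward
  else if H.directed v u then .backward
  else if H.undirected u v then .unoriented
  else .noEdge

/-! ### Discrete-time dynamic structural causal models -/

/-- A discrete-time dynamic structural causal model `Y_t := f^{y_t}(𝕏, L_t^{y_t})` with real-valued
variables. The set `𝕏` of direct causes of `Y_t` is the set of parents of `Y_t` in `graph`: the
function `f (Y, t)` is written on the values of all variables, and depends on those of the parents
only. The noise terms have an arbitrary joint law `noiseLaw`, and the noise term of a variable enters
the equation of that variable only. -/
structure DTDSCM (ι : Type*) (T : ℕ) where
  graph : FTDAG ι T
  Noise : ι → Type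
  [measurableSpaceNoise : ∀ i, MeasurableSpace (Noise i)]
  f : (v : TVar ι T) → (TVar ι T → ℝ) → Noise v.1 → ℝ
  measurable_f : ∀ v, Measurable fun p : (TVar ι T → ℝ) × Noise v.1 => f v p.1 p.2
  f_congr : ∀ v x y n, (∀ u, graph.edge u v → x u = y u) → f v x n = f v y n
  noiseLaw : Measure ((v : TVar ι T) → Noise v.1)
  [isProbabilityMeasure_noiseLaw : IsProbabilityMeasure noiseLaw]

attribute [instance] DTDSCM.measurableSpaceNoise DTDSCM.isProbabilityMeasure_noiseLaw

theorem FTDAG.wellFounded {ι : Type*} [Finite ι] {T : ℕ} (G : FTDAG ι T) :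
    WellFounded G.edge := by
  have : Std.Irrefl (Relation.TransGen G.edge) := ⟨G.acyclic⟩
  have h := Finite.wellFounded_of_trans_of_irrefl (Relation.TransGen G.edge)
  exact Subrelation.wf (fun h => Relation.TransGen.single h) h

namespace DTDSCM

variable {ι : Type*} [Finite ι] {T : ℕ}

open Classical in
/-- The solution of the structural equations for given values of the noise terms, by recursion along
the graph. -/
noncomputable def solution (M : DTDSCM ι T) (l : (v : TVar ι T) → M.Noise v.1) : TVar ι T → ℝ :=
  M.graph.wellFounded.fix fun v rec =>
    M.f v (fun u => if h : M.graph.edge u v then rec u h else 0) (l v)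

/-- `solution` solves the structural equations. -/
theorem solution_eq (M : DTDSCM ι T) (l : (v : TVar ι T) → M.Noise v.1) (v : TVar ι T) :
    M.solution l v = M.f v (M.solution l) (l v) := by
  unfold solution
  rw [WellFounded.fix_eq]
  apply M.f_congr
  intro u hu
  simp [hu]

theorem measurable_solution (M : DTDSCM ι T) : Measurable M.solution := by
  classical
  refine measurable_pi_iff.2 fun v => ?_
  induction v using M.graph.wellFounded.induction with
  | _ v ih =>
    have h : (fun l => M.solution l v) = fun l =>
        M.f v (fun u => if M.graph.edge u v then M.solution l u else 0) (l v) := by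
      funext l
      rw [M.solution_eq]
      apply M.f_congr
      intro u hu
      simp [hu]
    rw [h]
    have key : ∀ u, Measurable fun l => (if M.graph.edge u v then M.solution l u else 0) := by
      intro u
      by_cases hu : M.graph.edge u v
      · simpa only [if_pos hu] using ih u hu
      · simp only [if_neg hu, measurable_const]
    exact (M.measurable_f v).comp ((measurable_pi_iff.2 key).prodMk (measurable_pi_apply v))

/-- The distribution of the temporal variables that the model induces. -/
noncomputable def law (M : DTDSCM ι T) : Measure (TVar ι T → ℝ) := M.noiseLaw.map M.solution

instance (M : DTDSCM ι T) : IsProbabilityMeasure M.law :=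
  Measure.isProbabilityMeasure_map M.measurable_solution.aemeasurable

open Classical in
/-- The model after the intervention `do(w = x)`: the structural equation of `w` is replaced by the
constant `x`, all the others and the noise terms are kept. -/
noncomputable def intervene (M : DTDSCM ι T) (w : TVar ι T) (x : ℝ) : DTDSCM ι T where
  graph :=
    { edge := fun u v => M.graph.edge u v ∧ v ≠ w
      temporal := fun u v h => M.graph.temporal u v h.1
      acyclic := fun v h => M.graph.acyclic v (Relation.TransGen.mono (fun _ _ h => h.1) _ _ h) }
  Noise := M.Noise
  f := fun v y n => if v = w then x else M.f v y n
  measurable_f := fun v => by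
    by_cases hv : v = w
    · simp [hv]
    · simpa [hv] using M.measurable_f v
  f_congr := fun v y z n h => by
    by_cases hv : v = w
    · simp [hv]
    · simpa [hv] using M.f_congr v y z n fun u hu => h u ⟨hu, hv⟩
  noiseLaw := M.noiseLaw

/-- `P(v | do(w = x))`: the law of the variable `v` after the intervention. -/
noncomputable def doLaw (M : DTDSCM ι T) (w : TVar ι T) (x : ℝ) (v : TVar ι T) : Measure ℝ :=
  (M.intervene w x).law.map fun ω => ω v

/-- Causal sufficiency: the noise terms are mutually independent. (That each of them affects one
observed variable only is part of the form of the structural equations.) -/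
def CausallySufficient (M : DTDSCM ι T) : Prop :=
  iIndepFun (fun v l => l v) M.noiseLaw

/-- Faithfulness of the induced distribution to the induced full-time DAG. -/
def Faithful (M : DTDSCM ι T) : Prop := FaithfulTo M.law M.graph

/-- Stationarity: the structural function is the same at all times. So the graph is invariant under
time shifts, and `f^{y_s} = f^{y_t}` after the arguments are shifted from time `t` to time `s ≤ t`,
provided that none of the arguments of `f^{y_t}` is shifted to a time before the window. -/
def Stationary (M : DTDSCM ι T) : Prop :=
  M.graph.Stationary ∧
    ∀ (Y : ι) (s t : Fin T) (x y : TVar ι T → ℝ) (n : M.Noise Y), s ≤ t →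
      (∀ (X : ι) (r : Fin T), M.graph.edge (X, r) (Y, t) →
        ∃ r' : Fin T, (r' : ℕ) + (t : ℕ) = (r : ℕ) + (s : ℕ) ∧ y (X, r') = x (X, r)) →
      M.f (Y, s) y n = M.f (Y, t) x n

/-- The model induces a full-time DAG compatible with `S`, and it satisfies causal sufficiency,
faithfulness and stationarity. The laws of these models are the distributions `ℙ*` compatible with
the SCG. -/
structure Admissible (M : DTDSCM ι T) (S : SCG ι) : Prop where
  compatible : M.graph ∈ S.compatible T
  causallySufficient : M.CausallySufficient
  faithful : M.Faithful
  stationary : M.Stationary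

/-- Positivity at `w`: the joint law of `w` and of its parents dominates the product of the law of
`w` and the law of the parents. For discrete variables: `P(w = x) > 0` and `P(pa) > 0` imply
`P(w = x, pa) > 0`. -/
def PositiveAt (M : DTDSCM ι T) (w : TVar ι T) : Prop :=
  ((M.law.map fun ω => ω w).prod (M.law.map (valuesOn (M.graph.parents w)))).AbsolutelyContinuous
    (M.law.map fun ω => (ω w, valuesOn (M.graph.parents w) ω))

end DTDSCM

/-! ### s-identifiability and identifiability of total effects -/

section Identifiability

variable {ι : Type*} [Finite ι]

/-- The pair `{S_X, S_Z}` is s-identifiable from the SCG and all compatible distributions: whatever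
the distribution of an admissible model, `orient(X_t, Z_t)` differs from `1` in the FT-MPDAG that is
constructed from this distribution and `S`. (By faithfulness, `MEC(G)` is the set of full-time DAGs
whose conditional independencies are those of the distribution.) -/
def SIdentifiable (T : ℕ) (S : SCG ι) (X Z : ι) : Prop :=
  ∀ M : DTDSCM ι T, M.Admissible S →
    ∀ t : Fin T, (M.graph.mpdag S).orient (X, t) (Z, t) ≠ EdgeOrientation.unoriented

/-- The total effect `P(v | do(w = x))` is identifiable from the SCG and the observed distribution:
two admissible models that induce the same distribution, with positivity at the treatment, give the
same interventional law of `v`, for almost every value `x` of the treatment. -/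
def TotalEffectIdentifiable {T : ℕ} (S : SCG ι) (w v : TVar ι T) : Prop :=
  ∀ M₁ M₂ : DTDSCM ι T, M₁.Admissible S → M₂.Admissible S →
    M₁.PositiveAt w → M₂.PositiveAt w → M₁.law = M₂.law →
    ∀ᵐ x ∂(M₁.law.map fun ω => ω w), M₁.doLaw w x v = M₂.doLaw w x v

end Identifiability

/-! The observed law and the SCG determine the parents of the treatment, and the law together with
these parents determines the effect.

Parents. An admissible law satisfies the causal Markov condition (`CausallySufficient.causalMarkov`)
and is faithful, so two models with the same law entail the same independencies between disjoint
sets. Hence their graphs have the same adjacencies (`FTDAG.adjacent_of_entails`): of two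
non-adjacent variables, one is a non-descendant of the other and is separated from it by the other's
parents, whereas an edge `u → v` defeats every separating set, as shown by a model in which `v`
copies a fair coin `u`. Time orients all edges between different time points. A contemporaneous edge
at the treatment with opposite directions in the two graphs would be unoriented in the FT-MPDAG,
against s-identifiability (`DTDSCM.Admissible.parents_subset`).

Effect. Let `W` be the treatment, `Z` its parents and `ρ` the density of `P_W ⊗ P_Z` with respect to
the law of `(W, Z)`, which exists by positivity. The outcome under `do(W = x)` does not involve the
noise of `W`, and it agrees with the observed outcome when `x` is the observed value of `W`. With
the other noise terms fixed, `W` follows its mechanism given `Z`, and `ρ` reweights this to `P_W`.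
So the expectation of `ρ(W, Z) 1_A(W) 1_B(V)` is the integral of `P(V ∈ B | do(x))` over `A` against
`P_W` (`setLIntegral_doLaw`), and it depends on the law and the parent set only. -/

open scoped ENNReal

/-! ### Product measures, disintegration and densities. -/

section Measure

/-- In a product of probability spaces, resampling one coordinate does not change the law. -/
theorem map_update_pi_prod {I : Type*} [Fintype I] [DecidableEq I] {α : I → Type*}
    [∀ i, MeasurableSpace (α i)] (μ : ∀ i, Measure (α i)) [∀ i, IsProbabilityMeasure (μ i)]
    (w : I) :
    ((Measure.pi μ).prod (μ w)).map (fun p => Function.update p.1 w p.2) = Measure.pi μ := by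
  refine (Measure.pi_eq fun s hs => ?_).symm
  have hmeas : Measurable fun p : (∀ i, α i) × α w => Function.update p.1 w p.2 :=
    measurable_update'
  rw [Measure.map_apply hmeas (MeasurableSet.univ_pi hs)]
  have hpre : (fun p : (∀ i, α i) × α w => Function.update p.1 w p.2) ⁻¹' (Set.univ.pi s) =
      (Set.univ.pi (Function.update s w Set.univ)) ×ˢ s w := by
    ext ⟨l, n⟩
    simp only [Set.mem_preimage, Set.mem_pi, Set.mem_univ, true_implies, Set.mem_prod]
    constructor
    · intro h
      refine ⟨fun i => ?_, by simpa using h w⟩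
      by_cases hi : i = w
      · subst hi; simp
      · simpa [hi] using h i
    · rintro ⟨h, hn⟩ i
      by_cases hi : i = w
      · subst hi; simpa using hn
      · simpa [hi] using h i
  rw [hpre, Measure.prod_prod, Measure.pi_pi, ← Finset.prod_erase_mul _ _ (Finset.mem_univ w),
    ← Finset.prod_erase_mul Finset.univ (fun i => μ i (s i)) (Finset.mem_univ w)]
  congr 1
  rw [Function.update_self, measure_univ, mul_one]
  refine Finset.prod_congr rfl fun i hi => ?_
  rw [Function.update_of_ne (Finset.ne_of_mem_erase hi)]

/-- Families of finite measures on the line that agree almost everywhere on each measurable set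
agree almost everywhere. -/
theorem ae_measure_eq_of_forall_measurableSet {β : Type*} [MeasurableSpace β] {μ : Measure β}
    {κ η : β → Measure ℝ} [∀ b, IsFiniteMeasure (η b)]
    (h : ∀ B, MeasurableSet B → ∀ᵐ b ∂μ, κ b B = η b B) : ∀ᵐ b ∂μ, κ b = η b := by
  have hrat : ∀ᵐ b ∂μ, ∀ q : ℚ, κ b (Set.Iic (q : ℝ)) = η b (Set.Iic (q : ℝ)) :=
    ae_all_iff.2 fun q => h _ measurableSet_Iic
  filter_upwards [hrat, h _ MeasurableSet.univ] with b hb huniv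
  refine (ext_of_generate_finite _ (BorelSpace.measurable_eq.trans
    Real.borel_eq_generateFrom_Iic_rat) Real.isPiSystem_Iic_rat ?_ huniv.symm).symm
  intro s hs
  obtain ⟨q, rfl⟩ := Set.mem_iUnion.1 hs
  exact (hb q).symm

/-- A density of a product measure with respect to a disintegrated measure turns almost every
fibre into the first factor. -/
theorem ae_withDensity_kernel_eq {β : Type*} [MeasurableSpace β] {μ : Measure β}
    [IsFiniteMeasure μ] {κ : Kernel β ℝ} [IsFiniteKernel κ] {η : Measure ℝ} [IsFiniteMeasure η]
    {ρ : ℝ × β → ℝ≥0∞} (hρ : Measurable ρ)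
    (h : ((μ ⊗ₘ κ).map Prod.swap).withDensity ρ = η.prod μ) :
    ∀ᵐ b ∂μ, (κ b).withDensity (fun x => ρ (x, b)) = η := by
  refine ae_measure_eq_of_forall_measurableSet fun B hB => ?_
  have hρ' : Measurable (Function.uncurry fun b x => ρ (x, b)) := hρ.comp measurable_swap
  have hint : (fun b => ∫⁻ x in B, ρ (x, b) ∂κ b) =ᵐ[μ] fun _ => η B := by
    refine ae_eq_of_forall_setLIntegral_eq_of_sigmaFinite
      (Measurable.setLIntegral_kernel_prod_right hρ' hB) measurable_const fun s hs _ => ?_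
    -- Evaluating on rectangles with `B` fixed and `s` arbitrary identifies the fibre integrals
    -- almost everywhere.
    have hset := congrArg (fun m => m (B ×ˢ s)) h
    simp only [Measure.prod_prod] at hset
    have hρs : Measurable fun p : β × ℝ => ρ p.swap := hρ.comp measurable_swap
    rw [withDensity_apply _ (hB.prod hs), setLIntegral_map (hB.prod hs) hρ measurable_swap,
      Set.preimage_swap_prod, Measure.setLIntegral_compProd hρs hs hB] at hset
    simpa using hset
  filter_upwards [hint] with b hb
  rw [withDensity_apply _ hB]
  exact hb

end Measure

/-! ### Conditional independence from a disintegration. -/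

section CondIndep

/-- If a kernel in `k` disintegrates the joint law of `((k, g), f)`, then `f` and `g` are
conditionally independent given `k`. -/
theorem condIndepFun_of_map_eq_compProd {Ω β β' γ : Type*} {mΩ : MeasurableSpace Ω}
    [StandardBorelSpace Ω] {mβ : MeasurableSpace β} {mβ' : MeasurableSpace β'}
    {mγ : MeasurableSpace γ} [StandardBorelSpace β] [Nonempty β] [StandardBorelSpace β']
    [Nonempty β'] {μ : Measure Ω} [IsFiniteMeasure μ] {f : Ω → β} {g : Ω → β'} {k : Ω → γ}
    (hf : Measurable f) (hg : Measurable g) (hk : Measurable k) {κ : Kernel γ β}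
    [IsMarkovKernel κ]
    (h : μ.map (fun ω => ((k ω, g ω), f ω)) =
      μ.map (fun ω => (k ω, g ω)) ⊗ₘ κ.prodMkRight β')
    (h' : μ.map (fun ω => (k ω, f ω)) = μ.map k ⊗ₘ κ) :
    f ⟂ᵢ[k, hk; μ] g := by
  refine CondIndepFun.symm ?_
  rw [condIndepFun_iff_condDistrib_prod_ae_eq_prodMkRight hf hg hk]
  have h1 := condDistrib_ae_eq_of_measure_eq_compProd (fun ω => (k ω, g ω)) hf.aemeasurable h
  have h2 := condDistrib_ae_eq_of_measure_eq_compProd k hf.aemeasurable h'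
  -- `h2` holds almost everywhere for the law of `k`, a marginal of the law of `(k, g)`, and is
  -- pulled back to the latter.
  have h3 : ∀ᵐ p ∂(μ.map fun ω => (k ω, g ω)), condDistrib f k μ p.1 = κ p.1 := by
    have hmap : μ.map k = (μ.map fun ω => (k ω, g ω)).map Prod.fst := by
      rw [Measure.map_map measurable_fst (hk.prodMk hg)]
      rfl
    rw [hmap] at h2
    exact ae_of_ae_map measurable_fst.aemeasurable h2
  filter_upwards [h1, h3] with p hp1 hp3
  rw [hp1, Kernel.prodMkRight_apply, Kernel.prodMkRight_apply, hp3]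

end CondIndep

/-! ### Mechanisms, resampling of a noise term, and the causal Markov condition. -/

theorem FTDAG.parents_subset_nonDescendants {ι : Type*} {T : ℕ} (G : FTDAG ι T) (w : TVar ι T) :
    G.parents w ⊆ G.nonDescendants w := fun _ hu h =>
  G.acyclic w (Relation.TransGen.tail' h hu)

namespace DTDSCM

section Mechanism

variable {ι : Type*} {T : ℕ}

open Classical in
/-- The values `z` on `C`, continued by zero. -/
noncomputable def extendZero (C : Set (TVar ι T)) (z : C → ℝ) : TVar ι T → ℝ :=
  fun u => if h : u ∈ C then z ⟨u, h⟩ else 0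

theorem measurable_extendZero (C : Set (TVar ι T)) : Measurable (extendZero C) := by
  refine measurable_pi_iff.2 fun u => ?_
  unfold extendZero
  by_cases h : u ∈ C
  · simpa [h] using measurable_pi_apply (⟨u, h⟩ : C)
  · simp [h]

/-- The filler value zero is harmless, since a structural function reads the parents only. -/
theorem f_extendZero (M : DTDSCM ι T) (w : TVar ι T) (x : TVar ι T → ℝ) (n : M.Noise w.1) :
    M.f w (extendZero (M.graph.parents w) (valuesOn (M.graph.parents w) x)) n = M.f w x n :=
  M.f_congr w _ _ _ fun u hu => by
    have : u ∈ M.graph.parents w := hu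
    simp [extendZero, this, valuesOn]

theorem measurable_f_extendZero (M : DTDSCM ι T) (w : TVar ι T) :
    Measurable fun p : (M.graph.parents w → ℝ) × M.Noise w.1 =>
      M.f w (extendZero _ p.1) p.2 :=
  (M.measurable_f w).comp
    (((measurable_extendZero _).comp measurable_fst).prodMk measurable_snd)

/-- The mechanism of `w`: the law of `w` for given values of its parents. -/
noncomputable def mechanism (M : DTDSCM ι T) (w : TVar ι T) :
    Kernel (M.graph.parents w → ℝ) ℝ :=
  (Kernel.id ×ₖ Kernel.const _ (M.noiseLaw.map fun l => l w)).map
    fun p => M.f w (extendZero _ p.1) p.2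

instance (M : DTDSCM ι T) (w : TVar ι T) : IsProbabilityMeasure (M.noiseLaw.map fun l => l w) :=
  Measure.isProbabilityMeasure_map (measurable_pi_apply w).aemeasurable

instance (M : DTDSCM ι T) (w : TVar ι T) : IsMarkovKernel (M.mechanism w) :=
  Kernel.IsMarkovKernel.map _ (M.measurable_f_extendZero w)

theorem lintegral_mechanism (M : DTDSCM ι T) (w : TVar ι T) (x : TVar ι T → ℝ)
    {F : ℝ → ℝ≥0∞} (hF : Measurable F) :
    ∫⁻ y, F y ∂(M.mechanism w (valuesOn _ x)) =
      ∫⁻ n, F (M.f w x n) ∂(M.noiseLaw.map fun l => l w) := by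
  have hm := M.measurable_f_extendZero w
  have hFm : Measurable fun p : (M.graph.parents w → ℝ) × M.Noise w.1 =>
    F (M.f w (extendZero _ p.1) p.2) := hF.comp hm
  rw [mechanism, Kernel.lintegral_map _ hm _ hF, Kernel.lintegral_prod _ _ _ hFm,
    Kernel.lintegral_id']
  · simp [f_extendZero]
  · simpa using hFm.lintegral_prod_right'

end Mechanism

variable {ι : Type*} [Finite ι] {T : ℕ}

/-- The solutions of the structural equations are unique. -/
theorem eq_solution (M : DTDSCM ι T) {l : (v : TVar ι T) → M.Noise v.1} {y : TVar ι T → ℝ}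
    (hy : ∀ v, y v = M.f v y (l v)) : y = M.solution l := by
  funext v
  induction v using M.graph.wellFounded.induction with
  | _ v ih =>
    rw [hy, M.solution_eq]
    exact M.f_congr v _ _ _ ih

open Classical in
/-- The noise term of `w` only influences the descendants of `w`. -/
theorem solution_update (M : DTDSCM ι T) (l : (v : TVar ι T) → M.Noise v.1) (w : TVar ι T)
    (n : M.Noise w.1) {v : TVar ι T} (hv : v ∈ M.graph.nonDescendants w) :
    M.solution (Function.update l w n) v = M.solution l v := by
  induction v using M.graph.wellFounded.induction with
  | _ v ih =>
    have hvw : v ≠ w := by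
      rintro rfl
      exact hv Relation.ReflTransGen.refl
    rw [M.solution_eq, M.solution_eq, Function.update_of_ne hvw]
    exact M.f_congr v _ _ _ fun u hu => ih u hu fun h => hv (h.tail hu)

open Classical in
theorem solution_update_self (M : DTDSCM ι T) (l : (v : TVar ι T) → M.Noise v.1) (w : TVar ι T)
    (n : M.Noise w.1) :
    M.solution (Function.update l w n) w = M.f w (M.solution l) n := by
  rw [M.solution_eq, Function.update_self]
  exact M.f_congr w _ _ _ fun u hu =>
    M.solution_update l w n (M.graph.parents_subset_nonDescendants w hu)

open Classical in
/-- Under causal sufficiency, resampling one noise term does not change the law of the noise. -/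
theorem map_update_noiseLaw {M : DTDSCM ι T} (hM : M.CausallySufficient) (w : TVar ι T) :
    (M.noiseLaw.prod (M.noiseLaw.map fun l => l w)).map (fun p => Function.update p.1 w p.2) =
      M.noiseLaw := by
  have := Fintype.ofFinite (TVar ι T)
  have hpi := (iIndepFun_iff_map_fun_eq_pi_map
    fun v => (measurable_pi_apply v).aemeasurable).1 hM
  have (v : TVar ι T) : IsProbabilityMeasure (M.noiseLaw.map fun l => l v) :=
    Measure.isProbabilityMeasure_map (measurable_pi_apply v).aemeasurable
  have h := map_update_pi_prod (fun v => M.noiseLaw.map fun l => l v) w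
  rw [← hpi] at h
  simpa using h

open Classical in
theorem lintegral_noiseLaw {M : DTDSCM ι T} (hM : M.CausallySufficient) (w : TVar ι T)
    {F : ((v : TVar ι T) → M.Noise v.1) → ℝ≥0∞} (hF : Measurable F) :
    ∫⁻ l, F l ∂M.noiseLaw =
      ∫⁻ l, ∫⁻ n, F (Function.update l w n) ∂(M.noiseLaw.map fun l => l w) ∂M.noiseLaw := by
  have hupd : Measurable fun p : ((v : TVar ι T) → M.Noise v.1) × M.Noise w.1 =>
      Function.update p.1 w p.2 := measurable_update'
  conv_lhs => rw [← map_update_noiseLaw hM w]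
  rw [lintegral_map hF hupd]
  exact lintegral_prod _ (hF.comp hupd).aemeasurable

open Classical in
/-- Integration along the structural equation of `w`, for an integrand whose second argument does
not involve the noise of `w`. -/
theorem lintegral_solution_self {M : DTDSCM ι T} (hM : M.CausallySufficient) (w : TVar ι T)
    {F : ℝ → ((v : TVar ι T) → M.Noise v.1) → ℝ≥0∞} (hF : Measurable (Function.uncurry F))
    (hw : ∀ x l n, F x (Function.update l w n) = F x l) :
    ∫⁻ l, F (M.solution l w) l ∂M.noiseLaw =
      ∫⁻ l, ∫⁻ y, F y l ∂(M.mechanism w (valuesOn _ (M.solution l))) ∂M.noiseLaw := by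
  have hm : Measurable fun l => F (M.solution l w) l :=
    hF.comp (((measurable_pi_apply w).comp M.measurable_solution).prodMk measurable_id)
  rw [lintegral_noiseLaw hM w hm]
  refine lintegral_congr fun l => ?_
  have hFl : Measurable fun x => F x l := hF.comp measurable_prodMk_right
  rw [M.lintegral_mechanism w _ hFl]
  simp [hw, solution_update_self]

open Classical in
-- Resampling the noise of `w` leaves `H` fixed and redraws `w` from its mechanism, so the
-- conditional law of `w` given `H` is the mechanism at the parent values `p ∘ H`. This yields both
-- the Markov condition and the joint law of a treatment and its parents.
theorem map_noiseLaw_prodMk_solution {M : DTDSCM ι T} (hM : M.CausallySufficient) (w : TVar ι T)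
    {β : Type*} [MeasurableSpace β] {H : ((v : TVar ι T) → M.Noise v.1) → β} (hH : Measurable H)
    (hw : ∀ l n, H (Function.update l w n) = H l) {p : β → M.graph.parents w → ℝ}
    (hp : Measurable p) (hpH : ∀ l, p (H l) = valuesOn _ (M.solution l)) :
    M.noiseLaw.map (fun l => (H l, M.solution l w)) =
      M.noiseLaw.map H ⊗ₘ (M.mechanism w).comap p hp := by
  have hsol : Measurable fun l => M.solution l w :=
    (measurable_pi_apply w).comp M.measurable_solution
  refine Measure.ext_of_lintegral _ fun F hF => ?_
  rw [lintegral_map hF (hH.prodMk hsol), Measure.lintegral_compProd hF, lintegral_map _ hH]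
  · rw [lintegral_solution_self hM w (F := fun x l => F (H l, x))]
    · simp [hpH]
    · exact hF.comp ((hH.comp measurable_snd).prodMk measurable_fst)
    · simp [hw]
  · exact Measurable.lintegral_kernel_prod_right' (κ := (M.mechanism w).comap p hp) hF

/-- Causal sufficiency implies the causal Markov condition. -/
theorem CausallySufficient.causalMarkov {M : DTDSCM ι T} (hM : M.CausallySufficient) :
    CausalMarkov M.law M.graph := by
  classical
  intro w
  have hval (A : Set (TVar ι T)) : Measurable fun l => valuesOn A (M.solution l) :=
    (measurable_valuesOn A).comp M.measurable_solution
  have hw (l n) : valuesOn (M.graph.nonDescendants w) (M.solution (Function.update l w n)) =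
      valuesOn _ (M.solution l) := by
    funext u
    exact M.solution_update l w n u.2
  have hpa (l n) : valuesOn (M.graph.parents w) (M.solution (Function.update l w n)) =
      valuesOn _ (M.solution l) := by
    funext u
    exact M.solution_update l w n (M.graph.parents_subset_nonDescendants w u.2)
  have hev : Measurable fun ω : TVar ι T → ℝ => ω w := measurable_pi_apply w
  have key : (fun ω : TVar ι T → ℝ => ω w) ⟂ᵢ[valuesOn (M.graph.parents w),
      measurable_valuesOn _; M.law] valuesOn (M.graph.nonDescendants w) := by
    refine condIndepFun_of_map_eq_compProd (κ := M.mechanism w) hev (measurable_valuesOn _)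
      (measurable_valuesOn _) ?_ ?_
    -- The parents are already among the non-descendants; listing them separately makes the kernel a
    -- function of the first component, as `condIndepFun_of_map_eq_compProd` requires.
    · have := map_noiseLaw_prodMk_solution hM w
        (H := fun l => (valuesOn (M.graph.parents w) (M.solution l),
          valuesOn (M.graph.nonDescendants w) (M.solution l))) ((hval _).prodMk (hval _))
        (fun l n => by rw [hw, hpa]) (p := Prod.fst) measurable_fst (fun _ => rfl)
      rw [law, Measure.map_map (((measurable_valuesOn _).prodMk
        (measurable_valuesOn _)).prodMk hev) M.measurable_solution,
        Measure.map_map ((measurable_valuesOn _).prodMk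
        (measurable_valuesOn _)) M.measurable_solution]
      exact this
    · have := map_noiseLaw_prodMk_solution hM w (hval (M.graph.parents w)) hpa measurable_id
        (fun _ => rfl)
      rw [law, Measure.map_map ((measurable_valuesOn _).prodMk hev) M.measurable_solution,
        Measure.map_map (measurable_valuesOn _) M.measurable_solution]
      exact this
  have hfun : valuesOn {w} = (fun (x : ℝ) (_ : ({w} : Set (TVar ι T))) => x) ∘
      fun ω : TVar ι T → ℝ => ω w := by
    funext ω ⟨u, hu⟩
    obtain rfl := hu
    rfl
  rw [CondIndepVars, hfun]
  exact key.comp (ψ := id) (measurable_pi_iff.2 fun _ => measurable_id) measurable_id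

/-! ### Truncated factorization as a reweighting -/

/-- The values of the variables under `do(w = x)`. -/
noncomputable def doSolution (M : DTDSCM ι T) (w : TVar ι T) (x : ℝ)
    (l : (v : TVar ι T) → M.Noise v.1) : TVar ι T → ℝ :=
  (M.intervene w x).solution l

theorem doSolution_self (M : DTDSCM ι T) (w : TVar ι T) (x : ℝ)
    (l : (v : TVar ι T) → M.Noise v.1) : M.doSolution w x l w = x := by
  unfold doSolution
  exact (solution_eq _ _ _).trans (if_pos rfl)

theorem doSolution_of_ne (M : DTDSCM ι T) {w v : TVar ι T} (h : v ≠ w) (x : ℝ)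
    (l : (v : TVar ι T) → M.Noise v.1) :
    M.doSolution w x l v = M.f v (M.doSolution w x l) (l v) := by
  unfold doSolution
  exact (solution_eq _ _ _).trans (if_neg h)

/-- Uniqueness of solutions for the intervened equations; the identities for `doSolution` below
reduce to checking these equations. -/
theorem eq_doSolution (M : DTDSCM ι T) {w : TVar ι T} {x : ℝ}
    {l : (v : TVar ι T) → M.Noise v.1} {y : TVar ι T → ℝ} (hw : y w = x)
    (hy : ∀ v, v ≠ w → y v = M.f v y (l v)) : y = M.doSolution w x l := by
  refine (M.intervene w x).eq_solution fun v => ?_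
  by_cases h : v = w
  · subst h; exact hw.trans (if_pos rfl).symm
  · exact (hy v h).trans (if_neg h).symm

/-- Setting `w` to the value that it takes anyway changes nothing. -/
theorem doSolution_solution (M : DTDSCM ι T) (w : TVar ι T)
    (l : (v : TVar ι T) → M.Noise v.1) :
    M.doSolution w (M.solution l w) l = M.solution l :=
  (M.eq_doSolution rfl fun v _ => M.solution_eq l v).symm

open Classical in
-- The noise of `w` enters only the equation that the intervention removes. This lets the treatment
-- be integrated out with the potential outcome held fixed.
theorem doSolution_update (M : DTDSCM ι T) (w : TVar ι T) (x : ℝ)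
    (l : (v : TVar ι T) → M.Noise v.1) (n : M.Noise w.1) :
    M.doSolution w x (Function.update l w n) = M.doSolution w x l := by
  refine M.eq_doSolution (M.doSolution_self w x _) fun v hv => ?_
  rw [M.doSolution_of_ne hv, Function.update_of_ne hv]

/-- Joint measurability in the treatment value and the noise is what Fubini needs later. -/
theorem measurable_doSolution (M : DTDSCM ι T) (w : TVar ι T) :
    Measurable fun p : ℝ × ((v : TVar ι T) → M.Noise v.1) => M.doSolution w p.1 p.2 := by
  classical
  refine measurable_pi_iff.2 fun v => ?_
  induction v using M.graph.wellFounded.induction with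
  | _ v ih =>
    by_cases hv : v = w
    · subst hv
      simpa only [doSolution_self] using measurable_fst
    · have h : (fun p : ℝ × ((v : TVar ι T) → M.Noise v.1) => M.doSolution w p.1 p.2 v) =
          fun p => M.f v (fun u => if M.graph.edge u v then M.doSolution w p.1 p.2 u else 0)
            (p.2 v) := by
        funext p
        rw [M.doSolution_of_ne hv]
        refine M.f_congr _ _ _ _ fun u hu => ?_
        simp [hu]
      have key : ∀ u, Measurable fun p : ℝ × ((v : TVar ι T) → M.Noise v.1) =>
          (if M.graph.edge u v then M.doSolution w p.1 p.2 u else 0) := by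
        intro u
        by_cases hu : M.graph.edge u v
        · simpa only [if_pos hu] using ih u hu
        · simp only [if_neg hu, measurable_const]
      rw [h]
      exact (M.measurable_f v).comp ((measurable_pi_iff.2 key).prodMk
        ((measurable_pi_apply v).comp measurable_snd))

theorem doLaw_eq (M : DTDSCM ι T) (w v : TVar ι T) (x : ℝ) :
    M.doLaw w x v = M.noiseLaw.map fun l => M.doSolution w x l v :=
  Measure.map_map (measurable_pi_apply v) (M.intervene w x).measurable_solution

theorem doLaw_apply (M : DTDSCM ι T) (w v : TVar ι T) (x : ℝ) {B : Set ℝ}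
    (hB : MeasurableSet B) :
    M.doLaw w x v B = ∫⁻ l, B.indicator 1 (M.doSolution w x l v) ∂M.noiseLaw := by
  have hsol : Measurable fun l => M.doSolution w x l v :=
    (measurable_pi_apply v).comp ((M.measurable_doSolution w).comp measurable_prodMk_left)
  rw [doLaw_eq, ← lintegral_indicator_one hB, lintegral_map (measurable_one.indicator hB) hsol]

instance (M : DTDSCM ι T) (w v : TVar ι T) (x : ℝ) : IsProbabilityMeasure (M.doLaw w x v) :=
  Measure.isProbabilityMeasure_map (measurable_pi_apply v).aemeasurable

theorem measurable_doLaw_apply (M : DTDSCM ι T) (w v : TVar ι T) {B : Set ℝ}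
    (hB : MeasurableSet B) : Measurable fun x => M.doLaw w x v B := by
  simp_rw [M.doLaw_apply w v _ hB]
  exact Measurable.lintegral_prod_right' (ν := M.noiseLaw)
    (((measurable_one (α := ℝ≥0∞)).indicator hB).comp
      ((measurable_pi_apply v).comp (M.measurable_doSolution w)))

/-- Inverse probability weighting: under causal sufficiency and positivity, the averages of the
interventional laws over the law of the treatment are given by a density that depends on the
observed distribution and on the parents of the treatment only. -/
theorem setLIntegral_doLaw {M : DTDSCM ι T} (hM : M.CausallySufficient) {w : TVar ι T}
    (hpos : M.PositiveAt w) (v : TVar ι T) {A B : Set ℝ} (hA : MeasurableSet A)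
    (hB : MeasurableSet B) {C : Set (TVar ι T)} (hC : M.graph.parents w = C) :
    ∫⁻ x in A, M.doLaw w x v B ∂(M.law.map fun ω => ω w) =
      ∫⁻ ω, (((M.law.map fun ω => ω w).prod (M.law.map (valuesOn C))).rnDeriv
        (M.law.map fun ω => (ω w, valuesOn C ω)) (ω w, valuesOn C ω)) *
        (A.indicator 1 (ω w) * B.indicator 1 (ω v)) ∂M.law := by
  classical
  -- The free set `C` in the statement lets two models with equal parent sets produce literally the
  -- same density.
  subst hC
  set PW := M.law.map fun ω => ω w with hPW
  set PZ := M.law.map (valuesOn (M.graph.parents w)) with hPZ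
  set Q := M.law.map fun ω => (ω w, valuesOn (M.graph.parents w) ω) with hQ
  set ρ := (PW.prod PZ).rnDeriv Q with hρ_def
  have hev (u : TVar ι T) : Measurable fun ω : TVar ι T → ℝ => ω u := measurable_pi_apply u
  have hpaM := measurable_valuesOn (M.graph.parents w)
  have hρ : Measurable ρ := Measure.measurable_rnDeriv _ _
  have : IsProbabilityMeasure PW := Measure.isProbabilityMeasure_map (hev w).aemeasurable
  have : IsProbabilityMeasure PZ := Measure.isProbabilityMeasure_map hpaM.aemeasurable
  have : IsProbabilityMeasure Q :=
    Measure.isProbabilityMeasure_map ((hev w).prodMk hpaM).aemeasurable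
  -- Positivity is used here: without absolute continuity, `ρ` would recover only part of the
  -- product.
  have hdens : Q.withDensity ρ = PW.prod PZ := by
    have : (PW.prod PZ).HaveLebesgueDecomposition Q :=
      Measure.haveLebesgueDecomposition_of_sigmaFinite _ _
    exact Measure.withDensity_rnDeriv_eq _ _ hpos
  have hZ : Measurable fun l => valuesOn (M.graph.parents w) (M.solution l) :=
    hpaM.comp M.measurable_solution
  have hPZ' : PZ = M.noiseLaw.map fun l => valuesOn (M.graph.parents w) (M.solution l) := by
    rw [hPZ, law, Measure.map_map hpaM M.measurable_solution]
    rfl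
  have hpa (l n) : valuesOn (M.graph.parents w) (M.solution (Function.update l w n)) =
      valuesOn _ (M.solution l) := by
    funext u
    exact M.solution_update l w n (M.graph.parents_subset_nonDescendants w u.2)
  have hQ' : Q = (PZ ⊗ₘ M.mechanism w).map Prod.swap := by
    have h := map_noiseLaw_prodMk_solution hM w hZ hpa measurable_id (fun _ => rfl)
    rw [Kernel.comap_id, ← hPZ'] at h
    have hW : Measurable fun l => M.solution l w := (hev w).comp M.measurable_solution
    rw [← h, Measure.map_map measurable_swap (hZ.prodMk hW), hQ, law,
      Measure.map_map ((hev w).prodMk hpaM) M.measurable_solution]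
    rfl
  have hfib : ∀ᵐ l ∂M.noiseLaw,
      (M.mechanism w (valuesOn _ (M.solution l))).withDensity
        (fun x => ρ (x, valuesOn _ (M.solution l))) = PW := by
    have h := ae_withDensity_kernel_eq hρ (hQ' ▸ hdens)
    rw [hPZ'] at h
    exact ae_of_ae_map hZ.aemeasurable h
  have hind (D : Set ℝ) (hD : MeasurableSet D) : Measurable (D.indicator (1 : ℝ → ℝ≥0∞)) :=
    measurable_one.indicator hD
  have hdo : Measurable fun p : ℝ × ((v : TVar ι T) → M.Noise v.1) =>
      A.indicator (1 : ℝ → ℝ≥0∞) p.1 *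
        B.indicator (1 : ℝ → ℝ≥0∞) (M.doSolution w p.1 p.2 v) :=
    ((hind A hA).comp measurable_fst).mul ((hind B hB).comp
      ((hev v).comp (M.measurable_doSolution w)))
  have hρZ : Measurable fun p : ℝ × ((v : TVar ι T) → M.Noise v.1) =>
      ρ (p.1, valuesOn _ (M.solution p.2)) :=
    hρ.comp (measurable_fst.prodMk (hZ.comp measurable_snd))
  -- The observed outcome is written as the potential outcome at the observed treatment value
  -- (`doSolution_solution`), so that apart from this value the integrand is free of the noise of
  -- `w`.
  have hright := lintegral_solution_self hM w
    (F := fun x l => ρ (x, valuesOn _ (M.solution l)) *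
      (A.indicator 1 x * B.indicator 1 (M.doSolution w x l v)))
    (hρZ.mul hdo) (fun x l n => by rw [hpa, doSolution_update])
  simp only [doSolution_solution] at hright
  rw [law, lintegral_map _ M.measurable_solution]
  swap
  · exact (hρ.comp ((hev w).prodMk hpaM)).mul
      (((hind A hA).comp (hev w)).mul ((hind B hB).comp (hev v)))
  rw [hright]
  have hfib' : ∀ᵐ l ∂M.noiseLaw,
      ∫⁻ x, ρ (x, valuesOn _ (M.solution l)) *
        (A.indicator 1 x * B.indicator 1 (M.doSolution w x l v))
        ∂(M.mechanism w (valuesOn _ (M.solution l))) =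
      ∫⁻ x, A.indicator 1 x * B.indicator 1 (M.doSolution w x l v) ∂PW := by
    filter_upwards [hfib] with l hl
    conv_rhs => rw [← hl]
    exact (lintegral_withDensity_eq_lintegral_mul _ (hρZ.comp measurable_prodMk_right)
      (hdo.comp measurable_prodMk_right)).symm
  have hswap : Measurable (Function.uncurry fun (l : (v : TVar ι T) → M.Noise v.1) x =>
      A.indicator (1 : ℝ → ℝ≥0∞) x * B.indicator (1 : ℝ → ℝ≥0∞) (M.doSolution w x l v)) :=
    hdo.comp measurable_swap
  -- After the reweighting, the treatment is distributed as `PW` whatever the noise, so the two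
  -- integrals can be exchanged.
  rw [lintegral_congr_ae hfib', lintegral_lintegral_swap hswap.aemeasurable,
    ← lintegral_indicator hA]
  refine lintegral_congr fun x => ?_
  by_cases hx : x ∈ A
  · simp [hx, M.doLaw_apply w v x hB]
  · simp [hx]

/-- The weighted integral in `setLIntegral_doLaw` involves only the law and the parent set, which
the two models share. Equality of integrals over all `A` gives equality for almost every `x`. -/
theorem ae_doLaw_eq {M₁ M₂ : DTDSCM ι T} (h₁ : M₁.CausallySufficient)
    (h₂ : M₂.CausallySufficient) {w : TVar ι T} (hpos₁ : M₁.PositiveAt w)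
    (hpos₂ : M₂.PositiveAt w) (hlaw : M₁.law = M₂.law)
    (hpa : M₁.graph.parents w = M₂.graph.parents w) (v : TVar ι T) :
    ∀ᵐ x ∂(M₁.law.map fun ω => ω w), M₁.doLaw w x v = M₂.doLaw w x v := by
  refine ae_measure_eq_of_forall_measurableSet fun B hB => ?_
  have : IsProbabilityMeasure (M₁.law.map fun ω => ω w) :=
    Measure.isProbabilityMeasure_map (measurable_pi_apply w).aemeasurable
  refine ae_eq_of_forall_setLIntegral_eq_of_sigmaFinite (M₁.measurable_doLaw_apply w v hB)
    (M₂.measurable_doLaw_apply w v hB) fun A hA _ => ?_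
  rw [setLIntegral_doLaw h₁ hpos₁ v hA hB hpa, hlaw, setLIntegral_doLaw h₂ hpos₂ v hA hB rfl]

end DTDSCM

/-! ### Markov equivalent graphs have the same skeleton -/

section Skeleton

variable {ι : Type*} [Finite ι] {T : ℕ}

theorem CondIndepVars.symm {P : Measure (TVar ι T → ℝ)} [IsFiniteMeasure P]
    {A B C : Set (TVar ι T)} (h : CondIndepVars P A B C) : CondIndepVars P B A C :=
  CondIndepFun.symm h

theorem CondIndepVars.mono_right {P : Measure (TVar ι T → ℝ)} [IsFiniteMeasure P]
    {A B B' C : Set (TVar ι T)} (h : CondIndepVars P A B C) (hB : B' ⊆ B) :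
    CondIndepVars P A B' C :=
  CondIndepFun.comp (φ := id) (ψ := fun (x : B → ℝ) (u : B') => x ⟨u, hB u.2⟩) h measurable_id
    (measurable_pi_iff.2 fun _ => measurable_pi_apply _)

/-- A variable is separated from each non-descendant by its parents. -/
theorem FTDAG.entails_of_mem_nonDescendants (G : FTDAG ι T) {u v : TVar ι T}
    (h : u ∈ G.nonDescendants v) : G.Entails {v} {u} (G.parents v) := fun _ _ hQ =>
  (hQ v).mono_right (Set.singleton_subset_iff.2 h)

open Classical in
/-- The model in which `u` is a fair coin, its child `v` copies `u`, and all the other variables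
vanish. -/
noncomputable def coinModel (G : FTDAG ι T) {u v : TVar ι T} (h : G.edge u v) : DTDSCM ι T where
  graph := G
  Noise := fun _ => Bool
  f := fun w x n => if w = u then (if n then 1 else 0) else if w = v then x u else 0
  measurable_f := fun w => by
    by_cases hu : w = u
    · simp only [hu, if_true]
      exact (measurable_of_finite fun n : Bool => if n then (1 : ℝ) else 0).comp measurable_snd
    by_cases hv : w = v
    · simp only [if_neg hu, if_pos hv]
      exact (measurable_pi_apply u).comp measurable_fst
    · simp only [if_neg hu, if_neg hv]
      exact measurable_const
  f_congr := fun w x y n hxy => by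
    by_cases hv : w = v
    · subst hv
      simp only [hxy u h]
    · simp [hv]
  noiseLaw := Measure.infinitePi fun _ => (PMF.uniformOfFintype Bool).toMeasure

theorem coinModel_causallySufficient {ι : Type*} {T : ℕ} (G : FTDAG ι T) {u v : TVar ι T}
    (h : G.edge u v) :
    (coinModel G h).CausallySufficient :=
  iIndepFun_infinitePi (Ω := fun _ : TVar ι T => Bool)
    (P := fun _ => (PMF.uniformOfFintype Bool).toMeasure) (X := fun _ => id)
    fun _ => measurable_id

theorem FTDAG.ne_of_edge {ι : Type*} {T : ℕ} (G : FTDAG ι T) {u v : TVar ι T} (h : G.edge u v) :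
    v ≠ u := by
  rintro rfl
  exact G.acyclic v (Relation.TransGen.single h)

/-- An event that is conditionally independent of an almost sure copy of itself, given an almost
surely constant variable, is trivial. -/
theorem measureReal_eq_mul_self {Ω γ : Type*} {mΩ : MeasurableSpace Ω} {mγ : MeasurableSpace γ}
    {μ : Measure Ω} [IsProbabilityMeasure μ] {k : Ω → γ} (hk : Measurable k) {c : γ}
    (hkc : ∀ᵐ ω ∂μ, k ω = c) {E E' : Set Ω} (hE : MeasurableSet E) (hEE' : E' =ᵐ[μ] E)
    (hmul : μ⟦E ∩ E' | mγ.comap k⟧ =ᵐ[μ]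
      fun ω => (μ⟦E | mγ.comap k⟧) ω * (μ⟦E' | mγ.comap k⟧) ω) :
    μ.real E = μ.real E * μ.real E := by
  have h1 : μ⟦E' | mγ.comap k⟧ =ᵐ[μ] μ⟦E | mγ.comap k⟧ :=
    condExp_congr_ae (indicator_ae_eq_of_ae_eq_set hEE')
  have h2 : μ⟦E ∩ E' | mγ.comap k⟧ =ᵐ[μ] μ⟦E | mγ.comap k⟧ := by
    refine condExp_congr_ae (indicator_ae_eq_of_ae_eq_set ?_)
    simpa using (Filter.EventuallyEq.refl (ae μ) E).inter hEE'
  -- The conditional probability is a function of `k`, hence almost surely constant, and its mean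
  -- identifies the constant as the probability of `E`.
  obtain ⟨g, -, hg⟩ := (stronglyMeasurable_condExp (m := mγ.comap k) (μ := μ)
    (f := E.indicator fun _ => (1 : ℝ))).measurable.exists_eq_measurable_comp
  have hconst : ∀ᵐ ω ∂μ, (μ⟦E | mγ.comap k⟧) ω = g c := by
    filter_upwards [hkc] with ω hω
    rw [hg, Function.comp_apply, hω]
  have hint : ∫ ω, (μ⟦E | mγ.comap k⟧) ω ∂μ = μ.real E := by
    rw [integral_condExp hk.comap_le, integral_indicator_const _ hE]
    simp
  rw [integral_congr_ae hconst] at hint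
  have hgc : g c = μ.real E := by simpa using hint
  have hae : ∀ᵐ ω ∂μ, μ.real E = μ.real E * μ.real E := by
    filter_upwards [hmul, h1, h2, hconst] with ω hω h1ω h2ω h3ω
    rw [h1ω, h2ω, h3ω, hgc] at hω
    exact hω
  exact hae.exists.choose_spec

/-- A child is not separated from its parent by any set of other variables. -/
theorem FTDAG.not_entails_of_edge (G : FTDAG ι T) {u v : TVar ι T} (h : G.edge u v)
    {C : Set (TVar ι T)} (hu : u ∉ C) (hv : v ∉ C) : ¬ G.Entails {u} {v} C := by
  classical
  intro hE
  have hvu := G.ne_of_edge h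
  -- The coin model keeps all of `G` as its graph, even though most edges carry no influence; its
  -- law is therefore Markov for `G`, and the entailment applies to it.
  have hCI : CondIndepVars (coinModel G h).law {u} {v} C :=
    hE _ (coinModel_causallySufficient G h).causalMarkov
  have hm := (coinModel G h).measurable_solution
  have hsolu (l : TVar ι T → Bool) : (coinModel G h).solution l u = if l u then 1 else 0 :=
    ((coinModel G h).solution_eq l u).trans (if_pos rfl)
  have hsolv (l : TVar ι T → Bool) :
      (coinModel G h).solution l v = (coinModel G h).solution l u :=
    ((coinModel G h).solution_eq l v).trans ((if_neg hvu).trans (if_pos rfl))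
  have hsol (l : TVar ι T → Bool) (w : TVar ι T) (hwu : w ≠ u) (hwv : w ≠ v) :
      (coinModel G h).solution l w = 0 :=
    ((coinModel G h).solution_eq l w).trans ((if_neg hwu).trans (if_neg hwv))
  have hev (w : TVar ι T) : Measurable fun ω : TVar ι T → ℝ => ω w := measurable_pi_apply w
  have hae_v : ∀ᵐ ω ∂(coinModel G h).law, ω v = ω u := by
    rw [DTDSCM.law, ae_map_iff hm.aemeasurable (measurableSet_eq_fun (hev v) (hev u))]
    exact Filter.Eventually.of_forall hsolv
  have hae_C : ∀ᵐ ω ∂(coinModel G h).law, valuesOn C ω = 0 := by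
    have h0 : ∀ᵐ ω ∂(coinModel G h).law, ∀ w : C, ω w = 0 := by
      refine ae_all_iff.2 fun w => ?_
      rw [DTDSCM.law, ae_map_iff hm.aemeasurable (measurableSet_eq_fun (hev w) measurable_const)]
      exact Filter.Eventually.of_forall fun l => hsol l w
        (fun hw => hu (hw ▸ w.2)) (fun hw => hv (hw ▸ w.2))
    filter_upwards [h0] with ω hω
    exact funext hω
  have hEm : MeasurableSet ((fun ω : TVar ι T → ℝ => ω u) ⁻¹' {1}) :=
    hev u (measurableSet_singleton 1)
  have hhalf : (coinModel G h).law.real ((fun ω => ω u) ⁻¹' {1}) = 1 / 2 := by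
    have hpre : (coinModel G h).solution ⁻¹' ((fun ω => ω u) ⁻¹' {1}) =
        (Function.eval u ⁻¹' {true} : Set (TVar ι T → Bool)) := by
      have hiff (l : TVar ι T → Bool) : (coinModel G h).solution l u = 1 ↔ l u = true := by
        rw [hsolu]
        cases l u <;> simp
      exact Set.ext hiff
    have hcoin := (measurePreserving_eval_infinitePi
      (fun _ : TVar ι T => (PMF.uniformOfFintype Bool).toMeasure) u).measure_preimage
      (measurableSet_singleton true).nullMeasurableSet
    rw [PMF.toMeasure_apply_singleton _ _ (measurableSet_singleton true)] at hcoin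
    rw [measureReal_def, DTDSCM.law, Measure.map_apply hm hEm, hpre]
    refine (congrArg ENNReal.toReal hcoin).trans ?_
    simp
  have hmul := (condIndepFun_iff_condExp_inter_preimage_eq_mul (measurable_valuesOn {u})
    (measurable_valuesOn {v})).1 hCI ((fun x => x ⟨u, rfl⟩) ⁻¹' {1})
    ((fun x => x ⟨v, rfl⟩) ⁻¹' {1})
    (measurable_pi_apply _ (measurableSet_singleton 1))
    (measurable_pi_apply _ (measurableSet_singleton 1))
  have hEE' : ((fun ω => ω v) ⁻¹' {1} : Set (TVar ι T → ℝ)) =ᵐ[(coinModel G h).law]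
      ((fun ω => ω u) ⁻¹' {1} : Set (TVar ι T → ℝ)) := by
    filter_upwards [hae_v] with ω hω
    change (ω v = 1) = (ω u = 1)
    rw [hω]
  -- All variables in `C` vanish almost surely, so conditioning on them is void; the fair coin then
  -- gives `1/2 = 1/4`.
  have hsq := measureReal_eq_mul_self (measurable_valuesOn C) hae_C hEm hEE' hmul
  rw [hhalf] at hsq
  norm_num at hsq

/-- If all the independencies that `G₁` entails are entailed by `G₂`, then adjacent variables in
`G₂` are adjacent in `G₁`. -/
theorem FTDAG.adjacent_of_entails {G₁ G₂ : FTDAG ι T}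
    (h : ∀ A B C : Set (TVar ι T), Disjoint A B → Disjoint A C → Disjoint B C →
      G₁.Entails A B C → G₂.Entails A B C) {u v : TVar ι T} (huv : G₂.edge u v) :
    G₁.edge u v ∨ G₁.edge v u := by
  by_contra! hcon
  have hne := G₂.ne_of_edge huv
  -- The separating set is the parent set in `G₁` of whichever variable does not have the other as a
  -- descendant; acyclicity guarantees that there is one.
  by_cases hd : u ∈ G₁.nonDescendants v
  · have hv : v ∉ G₁.parents v := fun hv => G₁.ne_of_edge hv rfl
    have hE := h {v} {u} (G₁.parents v) (by simpa using hne) (by simpa using hv)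
      (Set.disjoint_singleton_left.2 hcon.1) (G₁.entails_of_mem_nonDescendants hd)
    exact G₂.not_entails_of_edge huv hcon.1 hv fun Q _ hQ => (hE Q hQ).symm
  · have hu : u ∉ G₁.parents u := fun hu => G₁.ne_of_edge hu rfl
    have hd' : v ∈ G₁.nonDescendants u := by
      intro hvu
      rcases Relation.reflTransGen_iff_eq_or_transGen.1 hvu with h' | h'
      · exact hne h'
      · exact G₁.acyclic u (h'.trans_left (not_not.1 hd))
    have hE := h {u} {v} (G₁.parents u) (by simpa using hne.symm) (by simpa using hu)
      (Set.disjoint_singleton_left.2 hcon.2) (G₁.entails_of_mem_nonDescendants hd')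
    exact G₂.not_entails_of_edge huv hu hcon.2 hE

end Skeleton

/-! ### From the observed law to the parents of the treatment. -/

section Identification

variable {ι : Type*} [Finite ι] {T : ℕ}

/-- Under causal sufficiency and faithfulness, the entailed independencies can be read off the
distribution. -/
theorem DTDSCM.Admissible.entails_iff {M : DTDSCM ι T} {S : SCG ι} (hM : M.Admissible S)
    {A B C : Set (TVar ι T)} (hAB : Disjoint A B) (hAC : Disjoint A C) (hBC : Disjoint B C) :
    M.graph.Entails A B C ↔ CondIndepVars M.law A B C :=
  ⟨fun h => h _ hM.causallySufficient.causalMarkov, hM.faithful A B C hAB hAC hBC⟩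

theorem DTDSCM.Admissible.mem_discoveryClass {M₁ M₂ : DTDSCM ι T} {S : SCG ι}
    (h₁ : M₁.Admissible S) (h₂ : M₂.Admissible S) (hlaw : M₁.law = M₂.law) :
    M₂.graph ∈ M₁.graph.discoveryClass S := by
  refine ⟨fun A B C hAB hAC hBC => ?_, h₂.compatible, h₂.stationary.1⟩
  rw [h₁.entails_iff hAB hAC hBC, h₂.entails_iff hAB hAC hBC]
  simp only [hlaw]

/-- The parents of the treatment are determined by the observed distribution. -/
theorem DTDSCM.Admissible.parents_subset {M₁ M₂ : DTDSCM ι T} {S : SCG ι} {X : ι} {s : Fin T}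
    (hS : ∀ Z ∈ S.neighbours X, SIdentifiable T S Z X) (h₁ : M₁.Admissible S)
    (h₂ : M₂.Admissible S) (hlaw : M₁.law = M₂.law) :
    M₂.graph.parents (X, s) ⊆ M₁.graph.parents (X, s) := by
  rintro ⟨Z, r⟩ (hedge : M₂.graph.edge (Z, r) (X, s))
  have hmem := h₁.mem_discoveryClass h₂ hlaw
  have hmem' := h₁.mem_discoveryClass h₁ rfl
  refine (FTDAG.adjacent_of_entails (fun A B C hAB hAC hBC => (hmem.1 A B C hAB hAC hBC).2)
    hedge).resolve_right fun hback => ?_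
  -- Opposite directions in the two graphs, neither pointing backwards in time, force a
  -- contemporaneous edge.
  obtain rfl : r = s :=
    le_antisymm (M₂.graph.temporal _ _ hedge) (M₁.graph.temporal _ _ hback)
  have hZX : Z ≠ X := by
    rintro rfl
    exact M₂.graph.ne_of_edge hedge rfl
  have hZ : Z ∈ S.neighbours X := by
    refine ⟨hZX, Or.inl ?_⟩
    have hcomp : M₂.graph.scg = S := h₂.compatible
    rw [← hcomp]
    exact ⟨r, r, le_rfl, hedge⟩
  have hasymm (G : FTDAG ι T) {u v : TVar ι T} (huv : G.edge u v) : ¬ G.edge v u := fun hvu =>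
    G.acyclic u ((Relation.TransGen.single huv).tail hvu)
  -- Both graphs lie in the discovery class of the first one and disagree on this edge, so it is
  -- unoriented there.
  refine hS Z hZ M₁ h₁ r ?_
  have hf : ¬ (M₁.graph.mpdag S).directed (Z, r) (X, r) := fun hd =>
    hasymm _ hback (hd _ hmem')
  have hb : ¬ (M₁.graph.mpdag S).directed (X, r) (Z, r) := fun hd =>
    hasymm _ hedge (hd _ hmem)
  have hundir : (M₁.graph.mpdag S).undirected (Z, r) (X, r) :=
    ⟨⟨_, hmem, hedge⟩, ⟨_, hmem', hback⟩⟩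
  simp only [PartiallyDirectedGraph.orient, if_neg hf, if_neg hb, if_pos hundir]

end Identification

theorem mainTheorem2 {ι : Type*} [Finite ι] {T : ℕ} (S : SCG ι) (X Y : ι) (s t : Fin T)
    (hst : s ≤ t)
    (hS : ∀ Z ∈ S.neighbours X, SIdentifiable T S Z X) :
    TotalEffectIdentifiable S (X, s) (Y, t) :=
  fun _ _ h₁ h₂ hpos₁ hpos₂ hlaw =>
    DTDSCM.ae_doLaw_eq h₁.causallySufficient h₂.causallySufficient hpos₁ hpos₂ hlaw
      (Set.Subset.antisymm (DTDSCM.Admissible.parents_subset hS h₂ h₁ hlaw.symm)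
        (DTDSCM.Admissible.parents_subset hS h₁ h₂ hlaw)) _
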